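/- A quadratic harmonic morphism $\varphi:\mathbb{R}^m\to\mathbb{R}^n$ is a map whose components are homogeneous polynomials of degree $2$ (the zero polynomial allowed) and which is a harmonic morphism: for every open $U\subseteq\mathbb{R}^n$ and every harmonic function $f:U\to\mathbb{R}$, the function $f\circ\varphi$ is harmonic on $\varphi^{-1}(U)$. Let $H_2(m,n)$ be the set of all quadratic harmonic morphisms $\mathbb{R}^m\to\mathbb{R}^n$. Two elements $\varphi,\tilde\varphi\in H_2(m,n)$ are domain-equivalent if $\varphi=\tilde\varphi\circ G$ for some orthogonal transformation $G\in O(\mathbb{R}^m)$. Let $\mathbb{A}_1=\mathbb{R}$, $\mathbb{A}_4=\mathbb{H}$ (the quaternions) and $\mathbb{A}_8=\mathbb{O}$ (the Cayley numbers, or octonions), each identified with $\mathbb{R}^n$, $n=1,4,8$ respectively, through its standard basis, and let $p_n:\mathbb{R}^{2n}=\mathbb{R}^n\times\mathbb{R}^n\to\mathbb{R}^n$, $p_n(x,y)=xy$, be the multiplication of $\mathbb{A}_n$. Theorem. For $n=1,4$ or $8$ and every $\varphi\in H_2(2n,n)$ there is a constant $c\in\mathbb{R}$ such that $c\,p_n\in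 H_2(2n,n)$ and $\varphi$ is domain-equivalent to $c\,p_n$. -/

import Mathlib

open scoped Quaternion

namespace QuadraticHarmonic

/-- Euclidean space `ℝᵐ`, with its standard inner product. -/
abbrev E (m : ℕ) : Type := EuclideanSpace ℝ (Fin m)

/-- A harmonic morphism `ℝᵐ → ℝⁿ`: it pulls back every harmonic function, defined on an open subset
`U` of `ℝⁿ`, to a harmonic function on the preimage of `U`. -/
def IsHarmonicMorphism {m n : ℕ} (φ : E m → E n) : Prop :=
  ∀ (U : Set (E n)) (f : E n → ℝ), IsOpen U →
    InnerProductSpace.HarmonicOnNhd f U → InnerProductSpace.HarmonicOnNhd (f ∘ φ) (φ ⁻¹' U)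

/-- The components of `φ` are quadratic forms, i.e. homogeneous polynomials of degree two in the
coordinates. -/
def IsQuadratic {m n : ℕ} (φ : E m → E n) : Prop :=
  ∀ i : Fin n, ∃ q : QuadraticForm ℝ (E m), ∀ x : E m, φ x i = q x

/-- The set of all quadratic harmonic morphisms `ℝᵐ → ℝⁿ`. -/
def H₂ (m n : ℕ) : Set (E m → E n) :=
  {φ | IsQuadratic φ ∧ IsHarmonicMorphism φ}

/-- Two quadratic harmonic morphisms are domain-equivalent if they differ by an orthogonal
transformation of the domain. -/
def DomainEquivalent {m n : ℕ} (φ ψ : E m → E n) : Prop :=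
  φ ∈ H₂ m n ∧ ψ ∈ H₂ m n ∧ ∃ G : E m ≃ₗᵢ[ℝ] E m, φ = ψ ∘ G

/-- The multiplication `(x, y) ↦ x * y` of `A`, read as a map `ℝ²ⁿ = ℝⁿ × ℝⁿ → ℝⁿ` in the
coordinates `e` of `A`. -/
def multiplicationMap {A : Type} [Mul A] {n : ℕ} (e : A ≃ (Fin n → ℝ)) (z : E (2 * n)) : E n :=
  WithLp.toLp 2 (e
    (e.symm (fun i => z ⟨i.val, by omega⟩) * e.symm (fun i => z ⟨n + i.val, by omega⟩)))

/-- The coordinate on the real line. -/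
def realCoord : ℝ ≃ (Fin 1 → ℝ) where
  toFun a := ![a]
  invFun v := v 0
  left_inv _ := rfl
  right_inv v := by
    funext i
    fin_cases i
    rfl

/-- The coordinates on the quaternions with respect to `1, i, j, k`. -/
def quaternionCoord : ℍ[ℝ] ≃ (Fin 4 → ℝ) where
  toFun a := ![a.re, a.imI, a.imJ, a.imK]
  invFun v := ⟨v 0, v 1, v 2, v 3⟩
  left_inv _ := rfl
  right_inv v := by
    funext i
    fin_cases i <;> rfl

/-- The Cayley numbers (octonions), as pairs of quaternions. -/
@[ext]
structure Cayley : Type where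
  fst : ℍ[ℝ]
  snd : ℍ[ℝ]

/-- The Cayley–Dickson product `(a, b) (c, d) = (a c - d̄ b, d a + b c̄)`. -/
noncomputable instance : Mul Cayley :=
  ⟨fun x y => ⟨x.fst * y.fst - star y.snd * x.snd, y.snd * x.fst + x.snd * star y.fst⟩⟩

/-- The coordinates on the Cayley numbers with respect to the standard basis
`(1, 0), (i, 0), (j, 0), (k, 0), (0, 1), (0, i), (0, j), (0, k)`. -/
def cayleyCoord : Cayley ≃ (Fin 8 → ℝ) where
  toFun a :=
    ![a.fst.re, a.fst.imI, a.fst.imJ, a.fst.imK, a.snd.re, a.snd.imI, a.snd.imJ, a.snd.imK]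
  invFun v := ⟨⟨v 0, v 1, v 2, v 3⟩, ⟨v 4, v 5, v 6, v 7⟩⟩
  left_inv _ := rfl
  right_inv v := by
    funext i
    fin_cases i <;> rfl

end QuadraticHarmonic

/-! Write the components of `φ` as `⟨A i x, x⟩` with `A i` symmetric. Pulling back the harmonic
polynomials `y i`, `y i * y j` and `y i ^ 2 - y j ^ 2` shows that each `A i` has trace zero and
that, at every `x`, the vectors `A i x` are orthogonal of equal length. By polarisation the `A i`
anticommute and have a common square (`exists_operators_of_mem_H₂`, `exists_cliffordSystem`). On an
eigenspace of that square with eigenvalue `c ^ 2 ≠ 0`, the `c⁻¹ • A i` form a Clifford system `P`.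

For `n = 4, 8` there is a unit vector `u` fixed by the words `P a P b P c P 0`, one for each
imaginary quaternionic triple. The `2n` vectors `P i (P 0 u)` and `P i u` are orthonormal, hence a
basis of `ℝ²ⁿ`, and the `P k` exchange the two halves with the signs of the multiplication table.
Coordinates in this basis give the orthogonal map `G` (`domainEquivalent_of_frame`). For `n = 1` the
trace condition alone supplies the basis. -/

namespace QuadraticHarmonic
open InnerProductSpace Laplacian

/-! ### Laplacians, and the operator equations of a quadratic harmonic morphism -/

/-- The Laplacian is invariant under linear isometries of the domain. -/
theorem laplacian_comp_linearIsometryEquiv {m : ℕ} (f : E m → ℝ) (G : E m ≃ₗᵢ[ℝ] E m) (x : E m) :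
    Δ (f ∘ G) x = Δ f (G x) := by
  -- The Laplacian can be computed in any orthonormal basis; for `f` the image under `G` of the
  -- standard one is used.
  rw [laplacian_eq_iteratedFDeriv_orthonormalBasis (f ∘ G) (EuclideanSpace.basisFun (Fin m) ℝ),
    laplacian_eq_iteratedFDeriv_orthonormalBasis f ((EuclideanSpace.basisFun (Fin m) ℝ).map G)]
  refine Finset.sum_congr rfl fun i _ => ?_
  have h := G.toContinuousLinearEquiv.iteratedFDerivWithin_comp_right (𝕜 := ℝ) f
    (s := Set.univ) uniqueDiffOn_univ (x := x) (Set.mem_univ _) 2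
  simp only [Set.preimage_univ, iteratedFDerivWithin_univ] at h
  change iteratedFDeriv ℝ 2 (f ∘ G.toContinuousLinearEquiv) x _ = _
  rw [h]
  simp only [ContinuousMultilinearMap.compContinuousLinearMap_apply, OrthonormalBasis.map_apply]
  congr 1
  ext j : 1
  fin_cases j <;> rfl

theorem harmonicAt_comp_linearIsometryEquiv {m : ℕ} {f : E m → ℝ} {G : E m ≃ₗᵢ[ℝ] E m} {x : E m}
    (h : HarmonicAt f (G x)) : HarmonicAt (f ∘ G) x := by
  refine ⟨h.1.comp x G.contDiff.contDiffAt, ?_⟩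
  filter_upwards [G.continuous.continuousAt.eventually h.2] with y hy
  rw [laplacian_comp_linearIsometryEquiv, hy]
  rfl

theorem comp_linearIsometryEquiv_mem_H₂ {m n : ℕ} {φ : E m → E n} (h : φ ∈ H₂ m n)
    (G : E m ≃ₗᵢ[ℝ] E m) : φ ∘ G ∈ H₂ m n := by
  refine ⟨fun i => ?_, fun U f hU hf x hx => ?_⟩
  · obtain ⟨q, hq⟩ := h.1 i
    exact ⟨q.comp G.toLinearEquiv.toLinearMap, fun x => hq (G x)⟩
  · exact harmonicAt_comp_linearIsometryEquiv (f := f ∘ φ) (h.2 U f hU hf (G x) hx)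

/-- Membership of `ψ` is inherited from `φ` through `G⁻¹`, so the multiplications never have to be
shown to be harmonic morphisms. -/
theorem domainEquivalent_of_eq {m n : ℕ} {φ ψ : E m → E n} (h : φ ∈ H₂ m n)
    (G : E m ≃ₗᵢ[ℝ] E m) (e : φ = ψ ∘ G) : DomainEquivalent φ ψ := by
  refine ⟨h, ?_, G, e⟩
  have : ψ = φ ∘ G.symm := by
    ext x : 1
    simp [e]
  exact this ▸ comp_linearIsometryEquiv_mem_H₂ h G.symm

theorem laplacian_eq_sum_fderiv_fderiv {m : ℕ} (f : E m → ℝ) (x : E m) :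
    Δ f x = ∑ k, fderiv ℝ (fderiv ℝ f) x (EuclideanSpace.basisFun (Fin m) ℝ k)
      (EuclideanSpace.basisFun (Fin m) ℝ k) := by
  rw [laplacian_eq_iteratedFDeriv_orthonormalBasis f (EuclideanSpace.basisFun (Fin m) ℝ)]
  simp [iteratedFDeriv_two_apply]

theorem laplacian_mul {m : ℕ} {f g : E m → ℝ} (hf : ContDiff ℝ 2 f) (hg : ContDiff ℝ 2 g)
    (x : E m) :
    Δ (f * g) x = f x * Δ g x + g x * Δ f x +
      2 * ∑ k, fderiv ℝ f x (EuclideanSpace.basisFun (Fin m) ℝ k) *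
        fderiv ℝ g x (EuclideanSpace.basisFun (Fin m) ℝ k) := by
  have df := hf.differentiable (by norm_num)
  have dg := hg.differentiable (by norm_num)
  have ddf : Differentiable ℝ (fderiv ℝ f) :=
    (hf.fderiv_right (m := 1) (by norm_num)).differentiable (by norm_num)
  have ddg : Differentiable ℝ (fderiv ℝ g) :=
    (hg.fderiv_right (m := 1) (by norm_num)).differentiable (by norm_num)
  have h : fderiv ℝ (f * g) = fun y => f y • fderiv ℝ g y + g y • fderiv ℝ f y := by
    ext1 y
    exact fderiv_mul (df y) (dg y)
  simp only [laplacian_eq_sum_fderiv_fderiv, Finset.mul_sum, ← Finset.sum_add_distrib]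
  refine Finset.sum_congr rfl fun k _ => ?_
  have h1 : DifferentiableAt ℝ (fun y => f y • fderiv ℝ g y) x := (df x).smul (ddg x)
  have h2 : DifferentiableAt ℝ (fun y => g y • fderiv ℝ f y) x := (dg x).smul (ddf x)
  rw [h, fderiv_fun_add h1 h2, fderiv_fun_smul (df x) (ddg x), fderiv_fun_smul (dg x) (ddf x)]
  simp
  ring

theorem laplacian_clm {m : ℕ} (l : E m →L[ℝ] ℝ) (x : E m) : Δ (l : E m → ℝ) x = 0 := by
  rw [laplacian_eq_sum_fderiv_fderiv]
  have : fderiv ℝ (l : E m → ℝ) = fun _ => l := by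
    ext1 y
    exact l.fderiv
  simp [this]

theorem harmonicAt_of_laplacian_eq_zero {m : ℕ} {f : E m → ℝ} (hf : ContDiff ℝ 2 f)
    (h : ∀ x, Δ f x = 0) (x : E m) : HarmonicAt f x :=
  ⟨hf.contDiffAt, Filter.Eventually.of_forall h⟩

theorem fderiv_inner_self {m : ℕ} {A : E m →L[ℝ] E m}
    (hA : ∀ x y, inner ℝ (A x) y = inner ℝ x (A y)) (x v : E m) :
    fderiv ℝ (fun y => inner ℝ (A y) y) x v = 2 * inner ℝ (A x) v := by
  have h := fderiv_inner_apply ℝ (f := A) (g := fun y => y) (x := x) A.differentiableAt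
    differentiableAt_id v
  rw [h]
  simp [hA v x, real_inner_comm v]
  ring

theorem laplacian_inner_self {m : ℕ} {A : E m →L[ℝ] E m}
    (hA : ∀ x y, inner ℝ (A x) y = inner ℝ x (A y)) (x : E m) :
    Δ (fun y => inner ℝ (A y) y) x = 2 * ∑ k, inner ℝ (A (EuclideanSpace.basisFun (Fin m) ℝ k))
      (EuclideanSpace.basisFun (Fin m) ℝ k) := by
  rw [laplacian_eq_sum_fderiv_fderiv, Finset.mul_sum]
  have : fderiv ℝ (fun y => inner ℝ (A y) y) = ((2 : ℝ) • (innerSL ℝ ∘L A) : E m →L[ℝ] _) := by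
    ext y v
    rw [fderiv_inner_self hA]
    rfl
  refine Finset.sum_congr rfl fun k _ => ?_
  rw [this, ContinuousLinearMap.fderiv]
  rfl

theorem exists_symmetric_of_quadraticForm {m : ℕ} (q : QuadraticForm ℝ (E m)) :
    ∃ A : E m →L[ℝ] E m, (∀ x, q x = inner ℝ (A x) x) ∧
      ∀ x y, inner ℝ (A x) y = inner ℝ x (A y) := by
  let B := QuadraticMap.associated (R := ℝ) q
  let A : E m →ₗ[ℝ] E m := (toDual ℝ (E m)).symm.toLinearEquiv.toLinearMap ∘ₗ
    LinearMap.toContinuousLinearMap.toLinearMap ∘ₗ B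
  have hA : ∀ x y, inner ℝ (A x) y = B x y := fun x y => by simp [A]
  refine ⟨A.toContinuousLinearMap, fun x => ?_, fun x y => ?_⟩
  · exact (QuadraticMap.associated_eq_self_apply ℝ q x).symm.trans (hA x x).symm
  · rw [real_inner_comm]
    simp only [LinearMap.coe_toContinuousLinearMap']
    rw [real_inner_comm, hA, real_inner_comm, hA]
    exact QuadraticMap.associated_isSymm ℝ q x y

/-- The infinitesimal form of being a quadratic harmonic morphism. -/
theorem exists_operators_of_mem_H₂ {m n : ℕ} {φ : E m → E n} (h : φ ∈ H₂ m n) :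
    ∃ A : Fin n → (E m →L[ℝ] E m), (∀ i x, φ x i = inner ℝ (A i x) x) ∧
      (∀ i x y, inner ℝ (A i x) y = inner ℝ x (A i y)) ∧
      (∀ i, ∑ k, inner ℝ (A i (EuclideanSpace.basisFun (Fin m) ℝ k))
        (EuclideanSpace.basisFun (Fin m) ℝ k) = 0) ∧
      (∀ i j, i ≠ j → ∀ x, inner ℝ (A i x) (A j x) = 0) ∧
      (∀ i j x, inner ℝ (A i x) (A i x) = inner ℝ (A j x) (A j x)) := by
  choose q hq using h.1
  choose A hA hs using fun i => exists_symmetric_of_quadraticForm (q i)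
  have e : ∀ i x, φ x i = inner ℝ (A i x) x := fun i x => (hq i x).trans (hA i x)
  have harm : ∀ f : E n → ℝ, ContDiff ℝ 2 f → (∀ x, Δ f x = 0) → ∀ x, Δ (f ∘ φ) x = 0 :=
    fun f hf h0 x => (h.2 Set.univ f isOpen_univ
      (fun y _ => harmonicAt_of_laplacian_eq_zero hf h0 y) x trivial).2.self_of_nhds
  let π : Fin n → E n → ℝ := fun i => EuclideanSpace.proj (𝕜 := ℝ) i
  have hπ : ∀ i, ContDiff ℝ 2 (π i) := fun i => ContinuousLinearMap.contDiff _
  have cq : ∀ i, ContDiff ℝ 2 (fun x => inner ℝ (A i x) x) :=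
    fun i => (A i).contDiff.inner ℝ contDiff_id
  have eπ : ∀ i, π i ∘ φ = fun x => inner ℝ (A i x) x := fun i => funext (e i)
  have tr : ∀ i, ∑ k, inner ℝ (A i (EuclideanSpace.basisFun (Fin m) ℝ k))
        (EuclideanSpace.basisFun (Fin m) ℝ k) = 0 := by
    intro i
    have h1 := harm _ (hπ i) (laplacian_clm _) 0
    rw [eπ, laplacian_inner_self (hs i)] at h1
    simpa using h1
  have lapπ : ∀ i j x, Δ (π i * π j) x = if i = j then 2 else 0 := by
    intro i j x
    rw [laplacian_mul (hπ i) (hπ j), laplacian_clm, laplacian_clm, ContinuousLinearMap.fderiv,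
      ContinuousLinearMap.fderiv]
    simp
  -- The gradient of `⟨A i x, x⟩` is `2 A i x` and the trace terms vanish, so the product rule
  -- leaves `2 * 2 * 2 = 8`.
  have lapφ : ∀ i j x, Δ ((π i * π j) ∘ φ) x = 8 * inner ℝ (A i x) (A j x) := by
    intro i j x
    have : ((π i * π j) ∘ φ) =
        (fun x => inner ℝ (A i x) x) * (fun x => inner ℝ (A j x) x) := by
      rw [← eπ, ← eπ]
      rfl
    rw [this, laplacian_mul (cq i) (cq j), laplacian_inner_self (hs i),
      laplacian_inner_self (hs j), tr, tr]
    simp only [fderiv_inner_self (hs _), mul_zero, zero_add]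
    rw [← (EuclideanSpace.basisFun (Fin m) ℝ).sum_inner_mul_inner (A i x), Finset.mul_sum,
      Finset.mul_sum]
    refine Finset.sum_congr rfl fun k _ => ?_
    rw [real_inner_comm (EuclideanSpace.basisFun (Fin m) ℝ k) (A j x)]
    ring
  refine ⟨A, e, hs, tr, fun i j hij x => ?_, fun i j x => ?_⟩
  · have h1 := harm (π i * π j) ((hπ i).mul (hπ j)) (fun x => by rw [lapπ, if_neg hij]) x
    rw [lapφ] at h1
    linarith
  · have c : ∀ i, ContDiff ℝ 2 (π i * π i) := fun i => (hπ i).mul (hπ i)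
    have c' : ∀ i, ContDiff ℝ 2 ((π i * π i) ∘ φ) := fun i => by
      have : ((π i * π i) ∘ φ) =
        (fun x => inner ℝ (A i x) x) * (fun x => inner ℝ (A i x) x) := by
        rw [← eπ]
        rfl
      rw [this]
      exact (cq i).mul (cq i)
    have h1 := harm (π i * π i - π j * π j) ((c i).sub (c j)) (fun x => by
      rw [ContDiffAt.laplacian_sub (c i).contDiffAt (c j).contDiffAt, lapπ, lapπ]; simp) x
    have h2 : ((π i * π i - π j * π j) ∘ φ) =
      (π i * π i) ∘ φ - (π j * π j) ∘ φ := rfl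
    rw [h2, ContDiffAt.laplacian_sub (c' i).contDiffAt (c' j).contDiffAt, lapφ, lapφ] at h1
    linarith

end QuadraticHarmonic

namespace QuadraticHarmonic

/-! ### Clifford systems: orthonormal families, fixed vectors, sign tables -/

/-- Anticommuting symmetric involutions of a Euclidean space. -/
structure IsCliffordSystem {n : ℕ} {V : Type*} [NormedAddCommGroup V] [InnerProductSpace ℝ V]
    (P : Fin n → Module.End ℝ V) : Prop where
  symm : ∀ i x y, inner ℝ (P i x) y = inner ℝ x (P i y)
  sq : ∀ i x, P i (P i x) = x
  anti : ∀ i j, i ≠ j → ∀ x, P i (P j x) = -P j (P i x)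

namespace IsCliffordSystem

variable {n : ℕ} {V : Type*} [NormedAddCommGroup V] [InnerProductSpace ℝ V]
  {P : Fin n → Module.End ℝ V}

/-- Oriented as a rewrite rule: together with `sq` it sorts words in the `P i`, so `simp` decides
identities between them. -/
theorem anti_of_lt (h : IsCliffordSystem P) {i j : Fin n} (hij : i < j) (x : V) :
    P j (P i x) = -P i (P j x) :=
  h.anti j i hij.ne' x

theorem inner_map_map (h : IsCliffordSystem P) (i : Fin n) (x y : V) :
    inner ℝ (P i x) (P i y) = inner ℝ x y := by
  rw [h.symm, h.sq]

theorem inner_map_map_of_ne (h : IsCliffordSystem P) {i j : Fin n} (hij : i ≠ j) (x : V) :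
    inner ℝ (P i x) (P j x) = 0 := by
  have h1 : inner ℝ (P i x) (P j x) = inner ℝ x (P i (P j x)) := h.symm i _ _
  have h2 : inner ℝ (P j x) (P i x) = inner ℝ x (P j (P i x)) := h.symm j _ _
  rw [h.anti i j hij, inner_neg_right, ← h2, real_inner_comm (P i x)] at h1
  linarith

theorem orthonormal_map (h : IsCliffordSystem P) {u : V} (hu : ‖u‖ = 1) :
    Orthonormal ℝ fun i => P i u := by
  rw [orthonormal_iff_ite]
  intro i j
  split_ifs with hij
  · subst hij
    rw [h.inner_map_map, real_inner_self_eq_norm_sq, hu, one_pow]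
  · exact h.inner_map_map_of_ne hij u

theorem norm_map (h : IsCliffordSystem P) (i : Fin n) (x : V) : ‖P i x‖ = ‖x‖ := by
  rw [norm_eq_sqrt_real_inner, norm_eq_sqrt_real_inner, h.inner_map_map]

/-- A unit vector fixed by a symmetric operator anticommuting with a Clifford system generates an
orthonormal family. -/
theorem orthonormal_sumElim [NeZero n] (h : IsCliffordSystem P) {u : V} (hu : ‖u‖ = 1)
    {ω : Module.End ℝ V} (hω : ∀ x y, inner ℝ (ω x) y = inner ℝ x (ω y))
    (hωP : ∀ i x, ω (P i x) = -P i (ω x)) (hωu : ω u = u) :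
    Orthonormal ℝ (Sum.elim (fun i => P i (P 0 u)) fun i => P i u) := by
  have hf : Orthonormal ℝ fun i => P i (P 0 u) := h.orthonormal_map (by rw [h.norm_map, hu])
  have hg : Orthonormal ℝ fun i => P i u := h.orthonormal_map hu
  have hfg : ∀ i j, inner ℝ (P i (P 0 u)) (P j u) = 0 := by
    intro i j
    -- `ω` has eigenvalue `1` on `P i (P 0 u)` and `-1` on `P j u`, so these are orthogonal.
    have h1 := hω (P i (P 0 u)) (P j u)
    simp only [hωP, hωu, map_neg, neg_neg, inner_neg_right] at h1
    linarith
  rw [orthonormal_iff_ite] at hf hg ⊢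
  rintro (i | i) (j | j)
  · simpa using hf i j
  · simpa using hfg i j
  · simpa [real_inner_comm] using hfg j i
  · simpa using hg i j

end IsCliffordSystem

/-- An involution anticommuting with another one has nonzero fixed vectors. -/
theorem exists_fixed_of_anticommute {V : Type*} [AddCommGroup V] [Module ℝ V] {p : V → Prop}
    {W T : Module.End ℝ V} (hp : ∃ u, u ≠ 0 ∧ p u) (hW : ∀ x, W (W x) = x)
    (hT : ∀ x, T (T x) = x) (hWT : ∀ x, W (T x) = -T (W x)) (hpW : ∀ x, p x → p (x + W x))
    (hpT : ∀ x, p x → p (T x)) : ∃ u, u ≠ 0 ∧ p u ∧ W u = u := by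
  obtain ⟨u, hu0, hu⟩ := hp
  -- Either `u + W u` is a nonzero fixed vector, or `W u = -u` and `T` carries `u` into the fixed
  -- space. The predicate `p` records fixed-point conditions already secured.
  by_cases h : u + W u = 0
  · refine ⟨T u, fun h0 => hu0 ?_, hpT u hu, ?_⟩
    · rw [← hT u, h0, map_zero]
    · rw [hWT, ← neg_eq_of_add_eq_zero_right h, map_neg, neg_neg]
  · exact ⟨_, h, hpW u hu, by rw [map_add, hW, add_comm]⟩

/-- The coefficient of `eₖ` in the product `eᵢ * eⱼ` of basis quaternions, where `j = i ^^^ k` is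
the bitwise exclusive disjunction. -/
def quaternionSign : Fin 4 → Fin 4 → ℝ :=
  ![![1, 1, 1, 1],
  ![-1, 1, -1, 1],
  ![-1, 1, 1, -1],
  ![-1, -1, 1, 1]]

/-- The coefficient of `eₖ` in the product `eᵢ * eⱼ` of basis Cayley numbers, where `j = i ^^^ k` is
the bitwise exclusive disjunction. -/
def cayleySign : Fin 8 → Fin 8 → ℝ :=
  ![![1, 1, 1, 1, 1, 1, 1, 1],
  ![-1, 1, -1, 1, -1, 1, 1, -1],
  ![-1, 1, 1, -1, -1, -1, 1, 1],
  ![-1, -1, 1, 1, -1, 1, -1, 1],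
  ![-1, 1, 1, 1, 1, -1, -1, -1],
  ![-1, -1, 1, -1, 1, 1, 1, -1],
  ![-1, -1, -1, 1, 1, -1, 1, 1],
  ![-1, 1, -1, -1, 1, 1, -1, 1]]

/-- On `u` the triple `(a, b, c)` behaves like `i, j, k`: the fixed-point equation is invariant
under cyclic shifts, and transpositions change the sign. -/
theorem IsCliffordSystem.mul_table_of_line {n : ℕ} [NeZero n] {V : Type*} [NormedAddCommGroup V]
    [InnerProductSpace ℝ V] {P : Fin n → Module.End ℝ V} (h : IsCliffordSystem P) {u : V}
    {a b c : Fin n} (hab : a ≠ b) (hbc : b ≠ c) (hac : a ≠ c)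
    (hu : P a (P b (P c (P 0 u))) = u) :
    (P b (P c (P 0 u)) = P a u ∧ P c (P b (P 0 u)) = -P a u) ∧
    (P c (P a (P 0 u)) = P b u ∧ P a (P c (P 0 u)) = -P b u) ∧
    (P a (P b (P 0 u)) = P c u ∧ P b (P a (P 0 u)) = -P c u) := by
  have h1 : P b (P c (P 0 u)) = P a u := by
    conv_rhs => rw [← hu, h.sq]
  have h2 : P c (P a (P 0 u)) = P b u := by
    conv_rhs => rw [← hu, h.anti a b hab, map_neg, h.sq, h.anti a c hac, neg_neg]
  have h3 : P a (P b (P 0 u)) = P c u := by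
    conv_rhs => rw [← hu, h.anti b c hbc, map_neg, map_neg, h.anti a c hac, map_neg, h.sq, neg_neg]
  refine ⟨⟨h1, ?_⟩, ⟨h2, ?_⟩, h3, ?_⟩
  · rw [h.anti c b hbc.symm, h1]
  · rw [h.anti a c hac, h2]
  · rw [h.anti b a hab.symm, h3]

end QuadraticHarmonic

namespace QuadraticHarmonic

/-! ### Frames realising the quaternion and Cayley tables -/

variable {V : Type*} [NormedAddCommGroup V] [InnerProductSpace ℝ V]

theorem IsCliffordSystem.exists_cayley_fixed [Nontrivial V] {P : Fin 8 → Module.End ℝ V}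
    (h : IsCliffordSystem P) :
    ∃ u, u ≠ 0 ∧ P 1 (P 2 (P 3 (P 0 u))) = u ∧ P 1 (P 4 (P 5 (P 0 u))) = u ∧
      P 2 (P 4 (P 6 (P 0 u))) = u ∧ P 1 (P 7 (P 6 (P 0 u))) = u := by
  let W (a b c : Fin 8) : Module.End ℝ V := P a * P b * P c * P 0
  have hW : ∀ a b c x, W a b c x = P a (P b (P c (P 0 x))) := fun _ _ _ _ => rfl
  have s1 : ∀ x, W 1 2 3 (W 1 2 3 x) = x := fun x => by simp [hW, h.anti_of_lt, h.sq]
  have s2 : ∀ x, W 1 4 5 (W 1 4 5 x) = x := fun x => by simp [hW, h.anti_of_lt, h.sq]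
  have s3 : ∀ x, W 2 4 6 (W 2 4 6 x) = x := fun x => by simp [hW, h.anti_of_lt, h.sq]
  have s4 : ∀ x, W 1 7 6 (W 1 7 6 x) = x := fun x => by simp [hW, h.anti_of_lt, h.sq]
  -- The triples are lines of the Fano plane. Two lines meet in one point, so two words share
  -- exactly two letters (that point and `0`) and commute.
  have c12 : ∀ x, W 1 2 3 (W 1 4 5 x) = W 1 4 5 (W 1 2 3 x) :=
    fun x => by simp [hW, h.anti_of_lt, h.sq]
  have c13 : ∀ x, W 1 2 3 (W 2 4 6 x) = W 2 4 6 (W 1 2 3 x) :=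
    fun x => by simp [hW, h.anti_of_lt, h.sq]
  have c14 : ∀ x, W 1 2 3 (W 1 7 6 x) = W 1 7 6 (W 1 2 3 x) :=
    fun x => by simp [hW, h.anti_of_lt, h.sq]
  have c23 : ∀ x, W 1 4 5 (W 2 4 6 x) = W 2 4 6 (W 1 4 5 x) :=
    fun x => by simp [hW, h.anti_of_lt, h.sq]
  have c24 : ∀ x, W 1 4 5 (W 1 7 6 x) = W 1 7 6 (W 1 4 5 x) :=
    fun x => by simp [hW, h.anti_of_lt, h.sq]
  have c34 : ∀ x, W 2 4 6 (W 1 7 6 x) = W 1 7 6 (W 2 4 6 x) :=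
    fun x => by simp [hW, h.anti_of_lt, h.sq]
  -- A triangular choice: `P 0`, `P 4`, `P 6`, `P 7` each anticommute with one word and, from the
  -- second on, commute with all earlier words, so the fixed-point conditions can be imposed one at
  -- a time.
  have t1 : ∀ x, W 1 2 3 (P 0 x) = -P 0 (W 1 2 3 x) := fun x => by simp [hW, h.anti_of_lt, h.sq]
  have t2 : ∀ x, W 1 4 5 (P 4 x) = -P 4 (W 1 4 5 x) := fun x => by simp [hW, h.anti_of_lt, h.sq]
  have t3 : ∀ x, W 2 4 6 (P 6 x) = -P 6 (W 2 4 6 x) := fun x => by simp [hW, h.anti_of_lt, h.sq]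
  have t4 : ∀ x, W 1 7 6 (P 7 x) = -P 7 (W 1 7 6 x) := fun x => by simp [hW, h.anti_of_lt, h.sq]
  have t12 : ∀ x, W 1 2 3 (P 4 x) = P 4 (W 1 2 3 x) := fun x => by simp [hW, h.anti_of_lt]
  have t13 : ∀ x, W 1 2 3 (P 6 x) = P 6 (W 1 2 3 x) := fun x => by simp [hW, h.anti_of_lt]
  have t14 : ∀ x, W 1 2 3 (P 7 x) = P 7 (W 1 2 3 x) := fun x => by simp [hW, h.anti_of_lt]
  have t23 : ∀ x, W 1 4 5 (P 6 x) = P 6 (W 1 4 5 x) := fun x => by simp [hW, h.anti_of_lt]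
  have t24 : ∀ x, W 1 4 5 (P 7 x) = P 7 (W 1 4 5 x) := fun x => by simp [hW, h.anti_of_lt]
  have t34 : ∀ x, W 2 4 6 (P 7 x) = P 7 (W 2 4 6 x) := fun x => by simp [hW, h.anti_of_lt]
  clear_value W
  obtain ⟨v, hv⟩ := exists_ne (0 : V)
  have e1 := exists_fixed_of_anticommute (p := fun _ : V => True) ⟨v, hv, trivial⟩ s1 (h.sq 0) t1
    (fun _ _ => trivial) (fun _ _ => trivial)
  have e2 := exists_fixed_of_anticommute (p := fun x => True ∧ W 1 2 3 x = x) e1 s2 (h.sq 4) t2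
    (fun x hx => by simp [c12, hx.2]) (fun x hx => by simp [t12, hx.2])
  have e3 := exists_fixed_of_anticommute (p := fun x => (True ∧ W 1 2 3 x = x) ∧ W 1 4 5 x = x)
    e2 s3 (h.sq 6) t3
    (fun x hx => by simp [c13, c23, hx.1.2, hx.2]) (fun x hx => by simp [t13, t23, hx.1.2, hx.2])
  obtain ⟨u, hu, ⟨⟨⟨-, h1⟩, h2⟩, h3⟩, h4⟩ := exists_fixed_of_anticommute
    (p := fun x => ((True ∧ W 1 2 3 x = x) ∧ W 1 4 5 x = x) ∧ W 2 4 6 x = x)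
    e3 s4 (h.sq 7) t4 (fun x hx => by simp [c14, c24, c34, hx.1.1.2, hx.1.2, hx.2])
    (fun x hx => by simp [t14, t24, t34, hx.1.1.2, hx.1.2, hx.2])
  simp only [hW] at h1 h2 h3 h4
  exact ⟨u, hu, h1, h2, h3, h4⟩

theorem IsCliffordSystem.exists_quaternion_fixed [Nontrivial V] {P : Fin 4 → Module.End ℝ V}
    (h : IsCliffordSystem P) : ∃ u, u ≠ 0 ∧ P 1 (P 2 (P 3 (P 0 u))) = u := by
  obtain ⟨v, hv⟩ := exists_ne (0 : V)
  obtain ⟨u, hu0, -, hu⟩ := exists_fixed_of_anticommute (p := fun _ : V => True)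
    (W := P 1 * P 2 * P 3 * P 0) (T := P 0) ⟨v, hv, trivial⟩
    (fun x => by simp [h.anti_of_lt, h.sq]) (h.sq 0) (fun x => by simp [h.anti_of_lt, h.sq])
    (fun _ _ => trivial) (fun _ _ => trivial)
  exact ⟨u, hu0, hu⟩

theorem IsCliffordSystem.exists_quaternion_frame [Nontrivial V] {P : Fin 4 → Module.End ℝ V}
    (h : IsCliffordSystem P) :
    ∃ f g : Fin 4 → V, Orthonormal ℝ (Sum.elim f g) ∧
      ∀ i k, P k (f i) = quaternionSign i k • g (i ^^^ k) := by
  obtain ⟨v, hv0, hv⟩ := h.exists_quaternion_fixed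
  obtain ⟨u, hu1, hu⟩ : ∃ u, ‖u‖ = 1 ∧ P 1 (P 2 (P 3 (P 0 u))) = u :=
    ⟨‖v‖⁻¹ • v, norm_smul_inv_norm (𝕜 := ℝ) hv0, by simp [hv]⟩
  have ho := h.orthonormal_sumElim hu1 (ω := P 1 * P 2 * P 3 * P 0)
    (fun x y => by simp [h.symm, h.anti_of_lt])
    (fun i x => by fin_cases i <;> simp [h.anti_of_lt, h.sq]) hu
  refine ⟨_, _, ho, fun i k => ?_⟩
  have t := h.mul_table_of_line (u := u) (by decide) (by decide) (by decide) hu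
  have t0 : ∀ i, i ≠ 0 → P 0 (P i (P 0 u)) = -P i u := fun i hi => by
    rw [h.anti 0 i hi.symm, h.sq]
  fin_cases i <;> fin_cases k <;> simp [quaternionSign, h.sq, t0, t]

theorem IsCliffordSystem.exists_cayley_frame [Nontrivial V] {P : Fin 8 → Module.End ℝ V}
    (h : IsCliffordSystem P) :
    ∃ f g : Fin 8 → V, Orthonormal ℝ (Sum.elim f g) ∧
      ∀ i k, P k (f i) = cayleySign i k • g (i ^^^ k) := by
  obtain ⟨v, hv0, hv1, hv2, hv3, hv4⟩ := h.exists_cayley_fixed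
  obtain ⟨u, hu, h1, h2, h3, h4⟩ : ∃ u, ‖u‖ = 1 ∧ P 1 (P 2 (P 3 (P 0 u))) = u ∧
      P 1 (P 4 (P 5 (P 0 u))) = u ∧ P 2 (P 4 (P 6 (P 0 u))) = u ∧
      P 1 (P 7 (P 6 (P 0 u))) = u :=
    ⟨‖v‖⁻¹ • v, norm_smul_inv_norm (𝕜 := ℝ) hv0, by simp [hv1], by simp [hv2], by simp [hv3],
      by simp [hv4]⟩
  -- The remaining three lines come from products of three of the four chosen words, in which
  -- repeated letters cancel.
  have h5 : P 2 (P 5 (P 7 (P 0 u))) = u := by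
    calc _ = P 2 (P 4 (P 6 (P 0 (P 1 (P 4 (P 5 (P 0 (P 1 (P 7 (P 6 (P 0 u))))))))))) := by
          simp [h.anti_of_lt, h.sq]
      _ = u := by rw [h4, h2, h3]
  have h6 : P 3 (P 4 (P 7 (P 0 u))) = u := by
    calc _ = P 2 (P 4 (P 6 (P 0 (P 1 (P 2 (P 3 (P 0 (P 1 (P 7 (P 6 (P 0 u))))))))))) := by
          simp [h.anti_of_lt, h.sq]
      _ = u := by rw [h4, h1, h3]
  have h7 : P 3 (P 6 (P 5 (P 0 u))) = u := by
    calc _ = P 2 (P 4 (P 6 (P 0 (P 1 (P 2 (P 3 (P 0 (P 1 (P 4 (P 5 (P 0 u))))))))))) := by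
          simp [h.anti_of_lt, h.sq]
      _ = u := by rw [h2, h1, h3]
  -- Up to sign this `ω` is the product of all eight `P i`, which anticommutes with each of them;
  -- written in this way it visibly fixes `u`.
  have ho := h.orthonormal_sumElim hu
    (ω := (P 1 * P 2 * P 3 * P 0) * (P 1 * P 4 * P 5 * P 0) * (P 1 * P 7 * P 6 * P 0))
    (fun x y => by simp [h.symm, h.anti_of_lt, h.sq])
    (fun i x => by fin_cases i <;> simp [h.anti_of_lt, h.sq]) (by simp [h1, h2, h4])
  refine ⟨_, _, ho, fun i k => ?_⟩
  have t1 := h.mul_table_of_line (u := u) (by decide) (by decide) (by decide) h1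
  have t2 := h.mul_table_of_line (u := u) (by decide) (by decide) (by decide) h2
  have t3 := h.mul_table_of_line (u := u) (by decide) (by decide) (by decide) h3
  have t4 := h.mul_table_of_line (u := u) (by decide) (by decide) (by decide) h4
  have t5 := h.mul_table_of_line (u := u) (by decide) (by decide) (by decide) h5
  have t6 := h.mul_table_of_line (u := u) (by decide) (by decide) (by decide) h6
  have t7 := h.mul_table_of_line (u := u) (by decide) (by decide) (by decide) h7
  have t0 : ∀ i, i ≠ 0 → P 0 (P i (P 0 u)) = -P i u := fun i hi => by
    rw [h.anti 0 i hi.symm, h.sq]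
  fin_cases i <;> fin_cases k <;> simp [cayleySign, h.sq, t0, t1, t2, t3, t4, t5, t6, t7]

end QuadraticHarmonic

namespace QuadraticHarmonic

/-! ### The multiplications in coordinates -/

theorem realCoord_apply (a : ℝ) : realCoord a = ![a] := rfl

theorem realCoord_symm_apply (v : Fin 1 → ℝ) : realCoord.symm v = v 0 := rfl

theorem quaternionCoord_apply (a : ℍ[ℝ]) : quaternionCoord a = ![a.re, a.imI, a.imJ, a.imK] := rfl

theorem re_quaternionCoord_symm (v : Fin 4 → ℝ) : (quaternionCoord.symm v).re = v 0 := rfl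

theorem imI_quaternionCoord_symm (v : Fin 4 → ℝ) : (quaternionCoord.symm v).imI = v 1 := rfl

theorem imJ_quaternionCoord_symm (v : Fin 4 → ℝ) : (quaternionCoord.symm v).imJ = v 2 := rfl

theorem imK_quaternionCoord_symm (v : Fin 4 → ℝ) : (quaternionCoord.symm v).imK = v 3 := rfl

theorem cayleyCoord_apply (a : Cayley) :
    cayleyCoord a = ![a.fst.re, a.fst.imI, a.fst.imJ, a.fst.imK,
      a.snd.re, a.snd.imI, a.snd.imJ, a.snd.imK] := rfl

theorem fst_re_cayleyCoord_symm (v : Fin 8 → ℝ) : (cayleyCoord.symm v).fst.re = v 0 := rfl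

theorem fst_imI_cayleyCoord_symm (v : Fin 8 → ℝ) : (cayleyCoord.symm v).fst.imI = v 1 := rfl

theorem fst_imJ_cayleyCoord_symm (v : Fin 8 → ℝ) : (cayleyCoord.symm v).fst.imJ = v 2 := rfl

theorem fst_imK_cayleyCoord_symm (v : Fin 8 → ℝ) : (cayleyCoord.symm v).fst.imK = v 3 := rfl

theorem snd_re_cayleyCoord_symm (v : Fin 8 → ℝ) : (cayleyCoord.symm v).snd.re = v 4 := rfl

theorem snd_imI_cayleyCoord_symm (v : Fin 8 → ℝ) : (cayleyCoord.symm v).snd.imI = v 5 := rfl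

theorem snd_imJ_cayleyCoord_symm (v : Fin 8 → ℝ) : (cayleyCoord.symm v).snd.imJ = v 6 := rfl

theorem snd_imK_cayleyCoord_symm (v : Fin 8 → ℝ) : (cayleyCoord.symm v).snd.imK = v 7 := rfl

theorem Cayley.fst_mul (x y : Cayley) : (x * y).fst = x.fst * y.fst - star y.snd * x.snd := rfl

theorem Cayley.snd_mul (x y : Cayley) : (x * y).snd = y.snd * x.fst + x.snd * star y.fst := rfl

theorem multiplicationMap_realCoord (z : E (2 * 1)) (k : Fin 1) :
    multiplicationMap realCoord z k = ∑ i : Fin 1, 1 * z ⟨i, by omega⟩ * z ⟨1 + i, by omega⟩ := by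
  fin_cases k
  simp [multiplicationMap, realCoord_apply, realCoord_symm_apply]

theorem multiplicationMap_quaternionCoord (z : E (2 * 4)) (k : Fin 4) :
    multiplicationMap quaternionCoord z k =
      ∑ i, quaternionSign i k * z ⟨i, by omega⟩ * z ⟨4 + (i ^^^ k : Fin 4), by omega⟩ := by
  fin_cases k <;>
  · simp [multiplicationMap, quaternionCoord_apply, re_quaternionCoord_symm,
      imI_quaternionCoord_symm, imJ_quaternionCoord_symm, imK_quaternionCoord_symm,
      Fin.sum_univ_succ, quaternionSign]
    ring

theorem multiplicationMap_cayleyCoord (z : E (2 * 8)) (k : Fin 8) :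
    multiplicationMap cayleyCoord z k =
      ∑ i, cayleySign i k * z ⟨i, by omega⟩ * z ⟨8 + (i ^^^ k : Fin 8), by omega⟩ := by
  fin_cases k <;>
  · simp [multiplicationMap, cayleyCoord_apply, Fin.sum_univ_succ, cayleySign, Cayley.fst_mul,
      Cayley.snd_mul, fst_re_cayleyCoord_symm, fst_imI_cayleyCoord_symm, fst_imJ_cayleyCoord_symm,
      fst_imK_cayleyCoord_symm, snd_re_cayleyCoord_symm, snd_imI_cayleyCoord_symm,
      snd_imJ_cayleyCoord_symm, snd_imK_cayleyCoord_symm]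
    ring

/-! ### From operators to frames and domain equivalence -/

/-- A quadratic map whose operators permute an orthonormal frame as the multiplication does is
domain-equivalent to a multiple of the multiplication. -/
theorem domainEquivalent_of_frame {n : ℕ} [NeZero n] {φ : E (2 * n) → E n} (hφ : φ ∈ H₂ (2 * n) n)
    {A : Fin n → (E (2 * n) →L[ℝ] E (2 * n))} (hA : ∀ i x, φ x i = inner ℝ (A i x) x)
    (hs : ∀ i x y, inner ℝ (A i x) y = inner ℝ x (A i y))
    {M : E (2 * n) → E n} {ε : Fin n → Fin n → ℝ} {σ : Fin n → Fin n → Fin n}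
    (hM : ∀ z k, M z k = ∑ i, ε i k * z ⟨i, by omega⟩ * z ⟨n + σ i k, by omega⟩)
    (hσ : ∀ k, Function.Bijective (σ · k)) {f g : Fin n → E (2 * n)}
    (ho : Orthonormal ℝ (Sum.elim f g)) {c : ℝ}
    (hf : ∀ i k, A k (f i) = (c * ε i k) • g (σ i k))
    (hg : ∀ i k, A k (g (σ i k)) = (c * ε i k) • f i) :
    DomainEquivalent φ ((2 * c) • M) := by
  have hcard : Fintype.card (Fin n ⊕ Fin n) = Module.finrank ℝ (E (2 * n)) := by
    simp [two_mul]
  let b : OrthonormalBasis (Fin n ⊕ Fin n) ℝ (E (2 * n)) :=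
    (basisOfOrthonormalOfCardEqFinrank ho hcard).toOrthonormalBasis (by simpa using ho)
  have hb : ∀ i, b i = Sum.elim f g i := fun i => by simp [b]
  let eqv : Fin n ⊕ Fin n ≃ Fin (2 * n) := finSumFinEquiv.trans (finCongr (two_mul n).symm)
  refine domainEquivalent_of_eq hφ (b.reindex eqv).repr ?_
  have hl : ∀ z (i : Fin n), (b.reindex eqv).repr z ⟨i, by omega⟩ = inner ℝ (f i) z := by
    intro z i
    have : (⟨i, by omega⟩ : Fin (2 * n)) = eqv (Sum.inl i) := by ext; simp [eqv]
    rw [this, OrthonormalBasis.repr_apply_apply]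
    simp [hb]
  have hr : ∀ z (i : Fin n), (b.reindex eqv).repr z ⟨n + i, by omega⟩ = inner ℝ (g i) z := by
    intro z i
    have : (⟨n + i, by omega⟩ : Fin (2 * n)) = eqv (Sum.inr i) := by ext; simp [eqv, add_comm]
    rw [this, OrthonormalBasis.repr_apply_apply]
    simp [hb]
  ext z k
  have e : ((2 * c) • M) ((b.reindex eqv).repr z) k = (2 * c) * M ((b.reindex eqv).repr z) k := rfl
  -- In the expansion of `⟨A k z, z⟩` over the frame, `f i` and `g (σ i k)` contribute equal terms,
  -- whence the factor `2 * c`; bijectivity of `σ · k` pairs them.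
  rw [Function.comp_apply, e, hM, hA, ← b.sum_inner_mul_inner, Fintype.sum_sum_type,
    ← (hσ k).sum_comp (fun j => inner ℝ (A k z) (b (Sum.inr j)) * inner ℝ (b (Sum.inr j)) z),
    ← Finset.sum_add_distrib, Finset.mul_sum]
  refine Finset.sum_congr rfl fun i _ => ?_
  rw [hl, hr, hs, hs, hb, hb]
  simp only [Sum.elim_inl, Sum.elim_inr, hf, hg, inner_smul_right]
  rw [real_inner_comm z (f i), real_inner_comm z (g (σ i k))]
  ring

/-- The operators of a nonzero quadratic harmonic morphism are, on a nonzero invariant subspace,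
proportional to a Clifford system. -/
theorem exists_cliffordSystem {m n : ℕ} [NeZero n] {A : Fin n → (E m →L[ℝ] E m)}
    (hs : ∀ i x y, inner ℝ (A i x) y = inner ℝ x (A i y))
    (h0 : ∀ i j, i ≠ j → ∀ x, inner ℝ (A i x) (A j x) = 0)
    (h1 : ∀ i j x, inner ℝ (A i x) (A i x) = inner ℝ (A j x) (A j x)) (hne : A 0 ≠ 0) :
    ∃ (V : Submodule ℝ (E m)) (P : Fin n → Module.End ℝ V) (c : ℝ), Nontrivial V ∧ c ≠ 0 ∧
      IsCliffordSystem P ∧ ∀ i (x : V), A i x = c • (P i x : E m) := by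
  -- A symmetric operator is determined by its quadratic form; this turns the pointwise relations
  -- into operator identities.
  have zero_of_inner : ∀ T : E m →ₗ[ℝ] E m, (∀ x y, inner ℝ (T x) y = inner ℝ x (T y)) →
      (∀ x, inner ℝ (T x) x = 0) → ∀ x, T x = 0 := fun T hT hx x => by
    rw [(LinearMap.IsSymmetric.inner_map_self_eq_zero (T := T) hT).1 hx, LinearMap.zero_apply]
  have anti : ∀ i j, i ≠ j → ∀ x, A i (A j x) = -A j (A i x) := by
    intro i j hij x
    have := zero_of_inner (A i ∘L A j + A j ∘L A i).toLinearMap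
      (fun x y => by simp [inner_add_left, inner_add_right, hs, add_comm])
      (fun x => by
        have e1 := hs i (A j x) x
        have e2 := hs j (A i x) x
        rw [h0 j i hij.symm] at e1
        rw [h0 i j hij] at e2
        simp [inner_add_left, e1, e2]) x
    exact eq_neg_of_add_eq_zero_left this
  have sq : ∀ i j x, A i (A i x) = A j (A j x) := by
    intro i j x
    have := zero_of_inner (A i ∘L A i - A j ∘L A j).toLinearMap
      (fun x y => by simp [inner_sub_left, inner_sub_right, hs])
      (fun x => by
        have e := h1 i j x
        rw [← hs i (A i x) x, ← hs j (A j x) x, ← sub_eq_zero] at e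
        simpa [inner_sub_left] using e) x
    exact sub_eq_zero.1 this
  obtain ⟨c, v, hc, hv0, hv⟩ : ∃ (c : ℝ) (v : E m), c ≠ 0 ∧ v ≠ 0 ∧ A 0 v = c • v := by
    have hsym : (A 0).toLinearMap.IsSymmetric := hs 0
    by_contra! hcon
    refine hne (ContinuousLinearMap.coe_injective
      ((hsym.eigenvectorBasis (finrank_euclideanSpace_fin)).toBasis.ext fun i => ?_))
    have h2 := hsym.apply_eigenvectorBasis finrank_euclideanSpace_fin i
    have h3 := (hsym.eigenvectorBasis finrank_euclideanSpace_fin).orthonormal.ne_zero i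
    simp only [RCLike.ofReal_real_eq_id, id_eq] at h2
    by_cases h4 : hsym.eigenvalues finrank_euclideanSpace_fin i = 0
    · rw [h4, zero_smul] at h2
      simpa using h2
    · exact absurd h2 (hcon _ _ h4 h3)
  let V : Submodule ℝ (E m) :=
    LinearMap.ker ((A 0 ∘L A 0).toLinearMap - (c * c) • LinearMap.id)
  have memV : ∀ x, x ∈ V ↔ A 0 (A 0 x) = (c * c) • x := fun x => by
    simp [V, sub_eq_zero]
  -- Each `A i` commutes with `A 0 ∘ A 0`, because the latter equals `A i ∘ A i`.
  have invV : ∀ i, ∀ x ∈ V, (c⁻¹ • (A i).toLinearMap) x ∈ V := by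
    intro i x hx
    rw [memV] at hx ⊢
    simp only [LinearMap.smul_apply, ContinuousLinearMap.coe_coe, map_smul]
    rw [sq 0 i (A i x), sq i 0 x, hx, map_smul, smul_comm]
  refine ⟨V, fun i => (c⁻¹ • (A i).toLinearMap).restrict (invV i), c,
    ⟨⟨v, (memV v).2 (by simp [hv, mul_smul])⟩, 0, fun h => hv0 (congrArg Subtype.val h)⟩, hc,
    ⟨fun i x y => ?_, fun i x => ?_, fun i j hij x => ?_⟩, fun i x => ?_⟩
  · simp [inner_smul_left, inner_smul_right, hs]
  · ext1
    have := (memV x).1 x.2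
    simp [sq i 0, this, smul_smul, hc]
  · ext1
    simp [anti i j hij]
  · simp [smul_smul, hc]

theorem domainEquivalent_zero {n : ℕ} [NeZero n] {φ M : E (2 * n) → E n} (hφ : φ ∈ H₂ (2 * n) n)
    {A : Fin n → (E (2 * n) →L[ℝ] E (2 * n))} (hA : ∀ i x, φ x i = inner ℝ (A i x) x)
    (h1 : ∀ i j x, inner ℝ (A i x) (A i x) = inner ℝ (A j x) (A j x)) (h0 : A 0 = 0) :
    DomainEquivalent φ ((0 : ℝ) • M) := by
  refine domainEquivalent_of_eq hφ (LinearIsometryEquiv.refl ℝ _) ?_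
  ext x i
  have : A i x = 0 := inner_self_eq_zero.1 ((h1 i 0 x).trans (by simp [h0]))
  simp [hA, this]

/-- The eigenspace `V` need not be known to be everything: a frame of `2n` orthonormal vectors
inside it already spans `ℝ²ⁿ`. -/
theorem exists_domainEquivalent_of_frame {n : ℕ} [NeZero n] {φ M : E (2 * n) → E n}
    (hφ : φ ∈ H₂ (2 * n) n) {ε : Fin n → Fin n → ℝ} {σ : Fin n → Fin n → Fin n}
    (hM : ∀ z k, M z k = ∑ i, ε i k * z ⟨i, by omega⟩ * z ⟨n + σ i k, by omega⟩)
    (hε : ∀ i k, ε i k * ε i k = 1) (hσ : ∀ k, Function.Bijective (σ · k))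
    (frame : ∀ (V : Submodule ℝ (E (2 * n))) (P : Fin n → Module.End ℝ V), Nontrivial V →
      IsCliffordSystem P → ∃ f g : Fin n → V, Orthonormal ℝ (Sum.elim f g) ∧
        ∀ i k, P k (f i) = ε i k • g (σ i k)) :
    ∃ c : ℝ, DomainEquivalent φ (c • M) := by
  obtain ⟨A, hA, hs, -, h0, h1⟩ := exists_operators_of_mem_H₂ hφ
  by_cases hne : A 0 = 0
  · exact ⟨0, domainEquivalent_zero hφ hA h1 hne⟩
  obtain ⟨V, P, c, hV, hc, hP, hAP⟩ := exists_cliffordSystem hs h0 h1 hne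
  obtain ⟨f, g, ho, hfg⟩ := frame V P hV hP
  have hgf : ∀ i k, P k (g (σ i k)) = ε i k • f i := fun i k => by
    rw [← hP.sq k (f i), hfg, map_smul, smul_smul, hε, one_smul]
  refine ⟨2 * c, domainEquivalent_of_frame hφ hA hs hM hσ (f := fun i => f i) (g := fun i => g i)
    (c := c) ?_ (fun i k => ?_) fun i k => ?_⟩
  · have := ho.comp_linearIsometry V.subtypeₗᵢ
    convert this using 1
    ext1 (i | i) <;> rfl
  · rw [hAP, hfg, mul_smul, V.coe_smul]
  · rw [hAP, hgf, mul_smul, V.coe_smul]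

/-! ### The case `n = 1` -/

/-- Trace zero in the plane makes the eigenvalues `±c`, so `A` swaps the normalised sum and
difference of the unit eigenvectors up to the factor `c`. A single operator satisfies no
anticommutation relation, so the trace must be used here. -/
theorem exists_null_frame {A : E (2 * 1) →L[ℝ] E (2 * 1)}
    (hs : ∀ x y, inner ℝ (A x) y = inner ℝ x (A y))
    (tr : ∑ k, inner ℝ (A (EuclideanSpace.basisFun (Fin (2 * 1)) ℝ k))
        (EuclideanSpace.basisFun (Fin (2 * 1)) ℝ k) = 0) :
    ∃ (f g : Fin 1 → E (2 * 1)) (c : ℝ), Orthonormal ℝ (Sum.elim f g) ∧ A (f 0) = c • g 0 ∧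
      A (g 0) = c • f 0 := by
  have hsym : A.toLinearMap.IsSymmetric := hs
  have hn : Module.finrank ℝ (E (2 * 1)) = 2 := finrank_euclideanSpace_fin
  have h1 := hsym.trace_eq_sum_eigenvalues hn
  rw [LinearMap.trace_eq_sum_inner _ (EuclideanSpace.basisFun (Fin (2 * 1)) ℝ)] at h1
  simp only [ContinuousLinearMap.coe_coe] at h1
  simp only [real_inner_comm] at tr h1
  rw [tr, Fin.sum_univ_two] at h1
  have h2 := hsym.apply_eigenvectorBasis hn
  have ho := orthonormal_iff_ite.1 (hsym.eigenvectorBasis hn).orthonormal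
  set u := hsym.eigenvectorBasis hn
  set l := hsym.eigenvalues hn
  simp only [RCLike.ofReal_real_eq_id, id_eq, ContinuousLinearMap.coe_coe] at h1 h2
  have h3 : l 1 = -l 0 := by linarith
  have hr : (√2)⁻¹ * (√2)⁻¹ = (2 : ℝ)⁻¹ := by
    rw [← mul_inv, Real.mul_self_sqrt (by norm_num)]
  refine ⟨fun _ => (√2)⁻¹ • (u 0 + u 1), fun _ => (√2)⁻¹ • (u 0 - u 1), l 0, ?_, ?_, ?_⟩
  · rw [orthonormal_iff_ite]
    rintro (i | i) (j | j) <;> obtain rfl := Subsingleton.elim i j <;>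
      simp only [Sum.elim_inl, Sum.elim_inr, real_inner_smul_left, real_inner_smul_right,
        inner_add_left, inner_add_right, inner_sub_left, inner_sub_right, ho, if_true,
        reduceCtorEq, if_false] <;>
      norm_num <;> linear_combination 2 * hr
  · simp only [map_smul, map_add, h2, h3]
    module
  · simp only [map_smul, map_sub, h2, h3]
    module

theorem exists_domainEquivalent_realCoord {φ : E (2 * 1) → E 1} (hφ : φ ∈ H₂ (2 * 1) 1) :
    ∃ c : ℝ, DomainEquivalent φ (c • multiplicationMap realCoord) := by
  obtain ⟨A, hA, hs, tr, -, -⟩ := exists_operators_of_mem_H₂ hφ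
  obtain ⟨f, g, c, ho, hf, hg⟩ := exists_null_frame (hs 0) (tr 0)
  refine ⟨2 * c, domainEquivalent_of_frame hφ hA hs (ε := fun _ _ => 1) (σ := fun i _ => i)
    multiplicationMap_realCoord (fun _ => Function.bijective_id) ho (fun i k => ?_) fun i k => ?_⟩
  · fin_cases i; fin_cases k; simpa using hf
  · fin_cases i; fin_cases k; simpa using hg

end QuadraticHarmonic

/-! ### The three cases together -/

theorem mainTheorem11 :
    (∀ φ ∈ QuadraticHarmonic.H₂ (2 * 1) 1, ∃ c : ℝ,
      QuadraticHarmonic.DomainEquivalent φ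
        (c • QuadraticHarmonic.multiplicationMap QuadraticHarmonic.realCoord)) ∧
    (∀ φ ∈ QuadraticHarmonic.H₂ (2 * 4) 4, ∃ c : ℝ,
      QuadraticHarmonic.DomainEquivalent φ
        (c • QuadraticHarmonic.multiplicationMap QuadraticHarmonic.quaternionCoord)) ∧
    (∀ φ ∈ QuadraticHarmonic.H₂ (2 * 8) 8, ∃ c : ℝ,
      QuadraticHarmonic.DomainEquivalent φ
        (c • QuadraticHarmonic.multiplicationMap QuadraticHarmonic.cayleyCoord)) := by
  refine ⟨fun φ hφ => QuadraticHarmonic.exists_domainEquivalent_realCoord hφ, fun φ hφ => ?_,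
    fun φ hφ => ?_⟩
  · exact QuadraticHarmonic.exists_domainEquivalent_of_frame hφ
      QuadraticHarmonic.multiplicationMap_quaternionCoord
      (fun i k => by fin_cases i <;> fin_cases k <;> norm_num [QuadraticHarmonic.quaternionSign])
      (by decide) (fun V P _ hP => hP.exists_quaternion_frame)
  · exact QuadraticHarmonic.exists_domainEquivalent_of_frame hφ
      QuadraticHarmonic.multiplicationMap_cayleyCoord
      (fun i k => by fin_cases i <;> fin_cases k <;> norm_num [QuadraticHarmonic.cayleySign])
      (by decide) (fun V P _ hP => hP.exists_cayley_frame)
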